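/- Let $M$ be a category with a model structure, and let $\mathcal C$ be a class (for instance a set) of cofibrations between cofibrant objects of $M$ such that the left Bousfield localization $L_{\mathcal C}(M)$ exists. That is, $L_{\mathcal C}(M)$ is a model structure on the same category with the same cofibrations, in which the maps of $\mathcal C$ are weak equivalences, such that the identity $M\to L_{\mathcal C}(M)$ is left Quillen, and every left Quillen functor $M\to N$ sending $\mathcal C$ to weak equivalences factors uniquely through it as a left Quillen functor $L_{\mathcal C}(M)\to N$. Write $L_{\mathcal C}:\mathrm{Ho}(M)\to \mathrm{Ho}(L_{\mathcal C}(M))\to\mathrm{Ho}(M)$ for the composition of the left and right derived functors of the identity, and $l:\mathrm{Id}\to L_{\mathcal C}$ for the unit of the derived adjunction. Let $T$ be a monad on $M$ with forgetful functor $U:\mathrm{Alg}_T\to M$. A semi-model structure on $\mathrm{Alg}_T$ over a model structure on $M$ is given by classes of weak equivalences, fibrations and cofibrations on $\mathrm{Alg}_T$ such that: $\mathrm{Alg}_T$ is bicomplete; $U$ preserves colimits indexed by non-empty ordinals; $U$ preserves and reflects fibrations and trivial fibrations; weak equivalences satisfy two-out-of-three; the three classes are closed under retracts; cofibrations have the left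 lifting property against trivial fibrations, and trivial cofibrations with cofibrant domain have it against fibrations; every map factors functorially as a cofibration followed by a trivial fibration, and every map with cofibrant domain factors functorially as a trivial cofibration followed by a fibration; the initial object is cofibrant; fibrations and trivial fibrations are closed under pullback. It is transferred if a map $f$ is a weak equivalence (resp. fibration) if and only if $U(f)$ is. Suppose that transferred semi-model structures $\mathrm{Alg}_T(M)$ (over $M$) and $\mathrm{Alg}_T(L_{\mathcal C}(M))$ (over $L_{\mathcal C}(M)$) exist on $\mathrm{Alg}_T$. Then: (a) $\mathrm{Alg}_T(L_{\mathcal C}(M))$ has functorial fibrant replacements: functors $Q,R$ and natural maps $E\xleftarrow{q_E}QE\xrightarrow{j_E}RE$ with $QE$ cofibrant, $q_E$ a trivial fibration, $j_E$ a trivial cofibration and $RE$ fibrant, all in $\mathrm{Alg}_T(L_{\mathcal C}(M))$. (b) For every such $(Q,R,q,j)$, $L_{\mathcal C}$ lifts to the homotopy category of $T$-algebras: there are an endofunctor $L^T$ of $\mathrm{Ho}(\mathrm{Alg}_T(M))$ with a natural transformation $l^T:\mathrm{Id}\to L^T$ such that $l^T_{L^TX}=L^T(l^T_X)$ is an isomorphism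 for all $X$, and a natural isomorphism $h:L_{\mathcal C}U\to UL^T$ of functors $\mathrm{Ho}(\mathrm{Alg}_T(M))\to\mathrm{Ho}(M)$ with $h\circ lU=Ul^T$. (c) $L^T$ is given by fibrant replacement in $\mathrm{Alg}_T(L_{\mathcal C}(M))$: there is an isomorphism $e_E:L^T(E)\cong RE$ in $\mathrm{Ho}(\mathrm{Alg}_T(M))$, natural in the $T$-algebra $E$, with $e_E\circ l^T_E\circ q_E=j_E$. (d) $h$ is obtained from a homotopy-unique lift $\beta$: let $E$ be a $T$-algebra and $k:U(QE)\to Z$ a trivial cofibration in $L_{\mathcal C}(M)$ with $Z$ fibrant in $L_{\mathcal C}(M)$. Then there is a map $\beta:Z\to U(RE)$ in $M$ with $\beta k=U(j_E)$; any two such maps are equal in $\mathrm{Ho}(M)$; every such map is a weak equivalence in $M$; and there is an isomorphism $a:Z\cong L_{\mathcal C}(UE)$ in $\mathrm{Ho}(M)$ with $a\circ k=l_{UE}\circ U(q_E)$ such that, for every such $\beta$, $U(e_E)\circ h_E\circ a=\beta$ in $\mathrm{Ho}(M)$. -/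

import Mathlib

open CategoryTheory Limits HomotopicalAlgebra

universe v v' u u'

noncomputable section

namespace LocAlg

/-! ### Model structures as explicit data

A category may carry several model structures, so model structures are passed explicitly. -/

section ModelStructures

variable {M : Type u} [Category.{v} M]

/-- The weak equivalences of a model structure. -/
abbrev weq (S : ModelCategory M) : MorphismProperty M :=
  @weakEquivalences M _ S.categoryWithWeakEquivalences

/-- The cofibrations of a model structure. -/
abbrev cof (S : ModelCategory M) : MorphismProperty M :=
  @cofibrations M _ S.categoryWithCofibrations

/-- The fibrations of a model structure. -/
abbrev fib (S : ModelCategory M) : MorphismProperty M :=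
  @fibrations M _ S.categoryWithFibrations

/-- `X` is cofibrant with respect to a class of cofibrations: the map from the initial object
to `X` is a cofibration (used only in categories with an initial object). -/
def CofibrantFor (Cof : MorphismProperty M) (X : M) : Prop :=
  ∀ ⦃I : M⦄ (hI : IsInitial I), Cof (hI.to X)

/-- `X` is fibrant with respect to a class of fibrations: the map from `X` to the terminal
object is a fibration (used only in categories with a terminal object). -/
def FibrantFor (Fib : MorphismProperty M) (X : M) : Prop :=
  ∀ ⦃I : M⦄ (hI : IsTerminal I), Fib (hI.from X)

lemma weq_id (S : ModelCategory M) (X : M) : weq S (𝟙 X) := by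
  let := S
  exact (weakEquivalences M).id_mem _

/-- The homotopy category of a model structure. -/
abbrev Ho (S : ModelCategory M) := (weq S).Localization

/-- The localization functor to the homotopy category. -/
abbrev toHo (S : ModelCategory M) : M ⥤ Ho S := (weq S).Q

/-- A left Quillen functor: a left adjoint preserving cofibrations and trivial cofibrations. -/
structure IsLeftQuillen {N : Type u'} [Category.{v'} N] (S : ModelCategory M)
    (P : ModelCategory N) (F : M ⥤ N) : Prop where
  isLeftAdjoint : F.IsLeftAdjoint
  map_cof : cof S ≤ (cof P).inverseImage F
  map_trivCof : cof S ⊓ weq S ≤ (cof P ⊓ weq P).inverseImage F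

/-- The model structure `L` is the left Bousfield localization of `S` with respect to the class
of maps `C`: it has the same cofibrations as `S`, its weak equivalences contain `C`, the
identity functor from `S` to `L` is left Quillen, and it is universal with these properties. -/
structure IsLeftBousfieldLocalization (S L : ModelCategory M) (C : MorphismProperty M) :
    Prop where
  cof_eq : cof L = cof S
  le_weq : C ≤ weq L
  isLeftQuillen_id : IsLeftQuillen S L (𝟭 M)
  universal : ∀ (N : Type u) [Category.{v} N] (P : ModelCategory N) (F : M ⥤ N),
    IsLeftQuillen S P F → C ≤ (weq P).inverseImage F →
      ∃! G : M ⥤ N, IsLeftQuillen L P G ∧ 𝟭 M ⋙ G = F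

end ModelStructures

/-! ### The localization functor on the homotopy category -/

namespace IsLeftBousfieldLocalization

variable {M : Type u} [Category.{v} M] {S L : ModelCategory M} {C : MorphismProperty M}

lemma trivFib_eq (hL : IsLeftBousfieldLocalization S L C) : fib L ⊓ weq L = fib S ⊓ weq S := by
  have h₁ := @MorphismProperty.rlp_eq_of_wfs M _ (cof L) (fib L ⊓ weq L)
    (letI := L; inferInstanceAs (MorphismProperty.IsWeakFactorizationSystem
      (cofibrations M) (trivialFibrations M)))
  have h₂ := @MorphismProperty.rlp_eq_of_wfs M _ (cof S) (fib S ⊓ weq S)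
    (letI := S; inferInstanceAs (MorphismProperty.IsWeakFactorizationSystem
      (cofibrations M) (trivialFibrations M)))
  rw [← h₁, ← h₂, hL.cof_eq]

lemma weq_le (hL : IsLeftBousfieldLocalization S L C) : weq S ≤ weq L := by
  intro X Y f hf
  let := S
  have fac := MorphismProperty.factorizationData (cofibrations M) (trivialFibrations M) f
  have hi : weakEquivalences M fac.i :=
    (weakEquivalences M).of_postcomp fac.i fac.p fac.hp.2 (by rw [fac.fac]; exact hf)
  have h₁ : weq L fac.i := (hL.isLeftQuillen_id.map_trivCof _ ⟨fac.hi, hi⟩).2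
  have h₂ : (fib L ⊓ weq L) fac.p := by
    rw [hL.trivFib_eq]
    exact fac.hp
  rw [← fac.fac]
  exact L.cm2.comp_mem _ _ h₁ h₂.2

lemma inverts_left (hL : IsLeftBousfieldLocalization S L C) : (weq S).IsInvertedBy (𝟭 M ⋙ toHo L) :=
  fun _ _ f hf => Localization.inverts (weq L).Q (weq L) f (hL.weq_le f hf)

lemma derives_right (hL : IsLeftBousfieldLocalization S L C) :
    (@FibrantObject.localizerMorphism M _ L).Derives (𝟭 M ⋙ toHo S) := by
  let := L
  intro X Y f hf
  have hf' : WeakEquivalence f.hom := ⟨hf⟩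
  have : IsFibrant X.obj := X.2
  have : IsFibrant Y.obj := Y.2
  obtain ⟨b⟩ : Nonempty (FibrantBrownFactorization f.hom) := inferInstance
  have hp : (fib S ⊓ weq S) b.p := by
    rw [← hL.trivFib_eq]
    exact ⟨b.hp, (weakEquivalences M).of_precomp b.i b.p b.hi.2 (by rw [b.fac]; exact hf)⟩
  have hr : (fib S ⊓ weq S) b.r := by
    rw [← hL.trivFib_eq]
    refine ⟨b.fibration_r.mem, (weakEquivalences M).of_precomp b.i b.r b.hi.2 ?_⟩
    rw [b.i_r]
    exact (weakEquivalences M).id_mem _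
  have hi : weq S b.i := by
    refine S.cm2.of_postcomp b.i b.r hr.2 ?_
    rw [b.i_r]
    exact weq_id S _
  have : weq S f.hom := by
    rw [← b.fac]
    exact S.cm2.comp_mem _ _ hi hp.2
  exact Localization.inverts (weq S).Q (weq S) _ this

lemma hasLeftDerived (hL : IsLeftBousfieldLocalization S L C) : (𝟭 M ⋙ toHo L).HasLeftDerivedFunctor (weq S) := by
  have := Functor.hasPointwiseLeftDerivedFunctor_of_inverts _ hL.inverts_left
  infer_instance

lemma hasRightDerived (hL : IsLeftBousfieldLocalization S L C) : (𝟭 M ⋙ toHo S).HasRightDerivedFunctor (weq L) := by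
  let := L
  have := hL.derives_right.hasPointwiseRightDerivedFunctor
  infer_instance

/-- The total left derived functor `Ho(M) ⥤ Ho(L_C(M))` of the identity functor. -/
def leftDerivedId (hL : IsLeftBousfieldLocalization S L C) : Ho S ⥤ Ho L :=
  haveI := hL.hasLeftDerived
  (𝟭 M ⋙ toHo L).totalLeftDerived (toHo S) (weq S)

/-- The structure map of the left derived functor of the identity. -/
def leftCounit (hL : IsLeftBousfieldLocalization S L C) : toHo S ⋙ hL.leftDerivedId ⟶ 𝟭 M ⋙ toHo L :=
  haveI := hL.hasLeftDerived
  (𝟭 M ⋙ toHo L).totalLeftDerivedCounit (toHo S) (weq S)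

/-- The total right derived functor `Ho(L_C(M)) ⥤ Ho(M)` of the identity functor. -/
def rightDerivedId (hL : IsLeftBousfieldLocalization S L C) : Ho L ⥤ Ho S :=
  haveI := hL.hasRightDerived
  (𝟭 M ⋙ toHo S).totalRightDerived (toHo L) (weq L)

/-- The structure map of the right derived functor of the identity. -/
def rightUnit (hL : IsLeftBousfieldLocalization S L C) : 𝟭 M ⋙ toHo S ⟶ toHo L ⋙ hL.rightDerivedId :=
  haveI := hL.hasRightDerived
  (𝟭 M ⋙ toHo S).totalRightDerivedUnit (toHo L) (weq L)

lemma isLeftDerived (hL : IsLeftBousfieldLocalization S L C) : hL.leftDerivedId.IsLeftDerivedFunctor hL.leftCounit (weq S) := by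
  have := hL.hasLeftDerived
  dsimp [leftDerivedId, leftCounit]
  infer_instance

lemma isRightDerived (hL : IsLeftBousfieldLocalization S L C) : hL.rightDerivedId.IsRightDerivedFunctor hL.rightUnit (weq L) := by
  have := hL.hasRightDerived
  dsimp [rightDerivedId, rightUnit]
  infer_instance

lemma isLeftDerived_comp (hL : IsLeftBousfieldLocalization S L C) : (hL.leftDerivedId ⋙ hL.rightDerivedId).IsLeftDerivedFunctor
    ((Functor.associator _ _ _).inv ≫ Functor.whiskerRight hL.leftCounit hL.rightDerivedId)
    (weq S) := by
  have := hL.isLeftDerived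
  have : IsIso hL.leftCounit :=
    Functor.isIso_of_isLeftDerivedFunctor_of_inverts _ hL.leftCounit hL.inverts_left
  exact Functor.isLeftDerivedFunctor_of_inverts (weq S) _ (asIso
    ((Functor.associator _ _ _).inv ≫ Functor.whiskerRight hL.leftCounit hL.rightDerivedId))

lemma isRightDerived_comp (hL : IsLeftBousfieldLocalization S L C) : (hL.rightDerivedId ⋙ hL.leftDerivedId).IsRightDerivedFunctor
    (Functor.whiskerRight hL.rightUnit hL.leftDerivedId ≫ (Functor.associator _ _ _).hom)
    (weq L) := by
  let := L
  have := hL.isRightDerived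
  have h : (@FibrantObject.localizerMorphism M _ L).Derives
      ((𝟭 M ⋙ toHo S) ⋙ hL.leftDerivedId) := by
    intro X Y f hf
    have := hL.derives_right f hf
    dsimp at this ⊢
    infer_instance
  refine h.isRightDerivedFunctor_of_isIso _ (fun X => ?_)
  have := hL.derives_right.isIso_of_isRightDerivedFunctor hL.rightUnit X
  dsimp at this ⊢
  infer_instance

/-- The derived adjunction `Ho(M) ⇄ Ho(L_C(M))` of the identity functors. -/
def derivedAdj (hL : IsLeftBousfieldLocalization S L C) : hL.leftDerivedId ⊣ hL.rightDerivedId :=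
  haveI := hL.isLeftDerived
  haveI := hL.isRightDerived
  haveI := hL.isLeftDerived_comp
  haveI := hL.isRightDerived_comp
  (Adjunction.id (C := M)).derived (weq S) (weq L) hL.leftCounit hL.rightUnit

/-- The localization functor `L_C : Ho(M) ⥤ Ho(M)`, the composition of the derived functors
`Ho(M) ⥤ Ho(L_C(M)) ⥤ Ho(M)`. -/
def loc (hL : IsLeftBousfieldLocalization S L C) : Ho S ⥤ Ho S := hL.leftDerivedId ⋙ hL.rightDerivedId

/-- The localization map `l : Id ⟶ L_C`, the unit of the derived adjunction. -/
def locMap (hL : IsLeftBousfieldLocalization S L C) : 𝟭 (Ho S) ⟶ hL.loc := hL.derivedAdj.unit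

end IsLeftBousfieldLocalization

/-! ### Semi-model structures -/

/-- A functorial factorization, as a morphism in `W₁` followed by a morphism in `W₂`, of those
arrows which satisfy `P`. -/
structure FunctorialFactorizationOn {D : Type u} [Category.{v} D] (P : ObjectProperty (Arrow D))
    (W₁ W₂ : MorphismProperty D) where
  Z : P.FullSubcategory ⥤ D
  i : P.ι ⋙ Arrow.leftFunc ⟶ Z
  p : Z ⟶ P.ι ⋙ Arrow.rightFunc
  fac : i ≫ p = Functor.whiskerLeft P.ι Arrow.leftToRight
  hi : ∀ f, W₁ (i.app f)
  hp : ∀ f, W₂ (p.app f)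

/-- A semi-model structure on `D`, relative to an adjunction `F ⊣ U` with `U : D ⥤ M` and a
model structure `S` on `M`. -/
structure SemiModelStructure {M : Type u} [Category.{v} M] {D : Type u'} [Category.{v'} D]
    {F : M ⥤ D} {U : D ⥤ M} (adj : F ⊣ U) (S : ModelCategory M) where
  weq : MorphismProperty D
  cof : MorphismProperty D
  fib : MorphismProperty D
  hasLimits : HasLimits D
  hasColimits : HasColimits D
  preservesColimits : ∀ (J : Type v') [LinearOrder J] [WellFoundedLT J] [Nonempty J],
    PreservesColimitsOfShape J U
  fib_iff : ∀ {X Y : D} (f : X ⟶ Y), fib f ↔ LocAlg.fib S (U.map f)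
  trivFib_iff : ∀ {X Y : D} (f : X ⟶ Y),
    (fib ⊓ weq) f ↔ (LocAlg.fib S ⊓ LocAlg.weq S) (U.map f)
  twoOutOfThree : weq.HasTwoOutOfThreeProperty
  weq_retract : weq.IsStableUnderRetracts
  cof_retract : cof.IsStableUnderRetracts
  fib_retract : fib.IsStableUnderRetracts
  lift_cof : ∀ {A B X Y : D} (i : A ⟶ B) (p : X ⟶ Y), cof i → (fib ⊓ weq) p →
    HasLiftingProperty i p
  lift_trivCof : ∀ {A B X Y : D} (i : A ⟶ B) (p : X ⟶ Y), CofibrantFor cof A →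
    (cof ⊓ weq) i → fib p → HasLiftingProperty i p
  factor_cof : cof.HasFunctorialFactorization (fib ⊓ weq)
  factor_trivCof : Nonempty (FunctorialFactorizationOn
    (fun f : Arrow D => CofibrantFor cof f.left) (cof ⊓ weq) fib)
  initial_cofibrant : ∀ {I : D}, IsInitial I → CofibrantFor cof I
  fib_baseChange : fib.IsStableUnderBaseChange
  trivFib_baseChange : (fib ⊓ weq).IsStableUnderBaseChange

namespace SemiModelStructure

variable {M : Type u} [Category.{v} M] {D : Type u'} [Category.{v'} D]
  {F : M ⥤ D} {U : D ⥤ M} {adj : F ⊣ U} {S : ModelCategory M}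

/-- The semi-model structure is transferred along `U`: a map `f` is a weak equivalence
(resp. fibration) if and only if `U f` is. -/
structure IsTransferred (A : SemiModelStructure adj S) : Prop where
  weq_iff : ∀ {X Y : D} (f : X ⟶ Y), A.weq f ↔ LocAlg.weq S (U.map f)
  fib_iff : ∀ {X Y : D} (f : X ⟶ Y), A.fib f ↔ LocAlg.fib S (U.map f)

/-- The homotopy category of a semi-model structure. -/
abbrev Ho (A : SemiModelStructure adj S) := A.weq.Localization

/-- The localization functor to the homotopy category. -/
abbrev toHo (A : SemiModelStructure adj S) : D ⥤ A.Ho := A.weq.Q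

/-- A functorial fibrant replacement in a semi-model category: a functorial cofibrant
replacement `q : Q E ⟶ E` by trivial fibrations, followed by a functorial replacement
`j : Q E ⟶ R E` by trivial cofibrations with fibrant targets. -/
structure FibrantReplacement (A : SemiModelStructure adj S) where
  Q : D ⥤ D
  R : D ⥤ D
  q : Q ⟶ 𝟭 D
  j : Q ⟶ R
  cofibrant : ∀ E, CofibrantFor A.cof (Q.obj E)
  trivFib_q : ∀ E, (A.fib ⊓ A.weq) (q.app E)
  trivCof_j : ∀ E, (A.cof ⊓ A.weq) (j.app E)
  fibrant : ∀ E, FibrantFor A.fib (R.obj E)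

namespace IsTransferred

variable {A : SemiModelStructure adj S} 

lemma inverts (hA : A.IsTransferred) : A.weq.IsInvertedBy (U ⋙ LocAlg.toHo S) :=
  fun _ _ f hf => Localization.inverts (LocAlg.weq S).Q (LocAlg.weq S) _ ((hA.weq_iff f).1 hf)

/-- The functor `U : Ho(D) ⥤ Ho(M)` induced by `U`, which preserves all weak equivalences. -/
def hoU (hA : A.IsTransferred) : A.Ho ⥤ LocAlg.Ho S := Localization.lift (U ⋙ LocAlg.toHo S) hA.inverts A.toHo

/-- The functor induced by `U` on homotopy categories is compatible with `U`. -/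
def hoUIso (hA : A.IsTransferred) : A.toHo ⋙ hA.hoU ≅ U ⋙ LocAlg.toHo S :=
  Localization.fac (U ⋙ LocAlg.toHo S) hA.inverts A.toHo

end IsTransferred

end SemiModelStructure

/-! ### Lifting a localization to the homotopy category of algebras -/

section Lift

variable {M : Type u} [Category.{v} M] {D : Type u'} [Category.{v'} D]
  {F : M ⥤ D} {U : D ⥤ M} {adj : F ⊣ U} {S L : ModelCategory M} {C : MorphismProperty M}

/-- A lift of the localization `L_C` to the homotopy category of algebras: an endofunctor `LT`
with localization maps `lT : Id ⟶ LT` (that is, an idempotent coaugmented functor), together with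
a natural isomorphism `h : L_C U ≅ U LT` such that `h ∘ l U = U lT`. -/
structure HomotopyLift (hL : IsLeftBousfieldLocalization S L C)
    {A : SemiModelStructure adj S} (hA : A.IsTransferred) where
  LT : A.Ho ⥤ A.Ho
  lT : 𝟭 A.Ho ⟶ LT
  idem : ∀ X, lT.app (LT.obj X) = LT.map (lT.app X)
  isIso_idem : ∀ X, IsIso (LT.map (lT.app X))
  h : hA.hoU ⋙ hL.loc ≅ LT ⋙ hA.hoU
  comm : ∀ X, hL.locMap.app (hA.hoU.obj X) ≫ h.hom.app X = hA.hoU.map (lT.app X)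

/-- The lifted localization `(LT, lT)` is given by the fibrant replacement `ρ`: the isomorphism
`e` identifies `LT` with the functor induced by `ρ.R`, and `lT` with the
map `E ⟵ Q E ⟶ R E`. -/
structure HomotopyLift.GivenBy {hL : IsLeftBousfieldLocalization S L C}
    {A : SemiModelStructure adj S} {hA : A.IsTransferred} (Λ : HomotopyLift hL hA)
    {B : SemiModelStructure adj L} (ρ : B.FibrantReplacement) where
  e : A.toHo ⋙ Λ.LT ≅ ρ.R ⋙ A.toHo
  fac : ∀ E : D, A.toHo.map (ρ.q.app E) ≫ Λ.lT.app (A.toHo.obj E) ≫ e.hom.app E =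
    A.toHo.map (ρ.j.app E)

end Lift

end LocAlg

end

noncomputable section

namespace LocAlg

/-! A model structure and its localization share cofibrations, hence trivial fibrations. By Ken
Brown's argument, local equivalences between locally fibrant objects are weak equivalences of `S`
(`weq_of_fibrant`). The derived localization `L_C` inverts all local equivalences (`isIso_loc_map`),
and its unit `l` is invertible on locally fibrant objects (`isIso_locMap_app`).

For algebras everything is tested after `U`. Since `U (R E)` is locally fibrant, `R` turns weak
equivalences into weak equivalences of `A`, so it descends to `hoR`; the coaugmentation is the
inverse of `q` followed by `j`. In `L_C U ⟶ L_C U R ⟵ U R` the left map is invertible because `U j`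
is a local equivalence, the right one because `U (R E)` is local. This zigzag is `h` (`locIso`).
Finally, maps in `Ho S` into a local object are determined by restriction along a local equivalence
(`hom_ext`), which identifies `h` with `β`. -/

lemma FibrantFor.of_isTerminal {M : Type u} [Category.{v} M] {Fib : MorphismProperty M}
    [Fib.RespectsIso] {X I : M} (hI : IsTerminal I) (h : Fib (hI.from X)) : FibrantFor Fib X := by
  intro J hJ
  have : hJ.from X = hI.from X ≫ (hI.uniqueUpToIso hJ).hom := hJ.hom_ext _ _
  rw [this]
  exact MorphismProperty.RespectsIso.postcomp _ _ _ h

lemma CofibrantFor.of_isInitial {M : Type u} [Category.{v} M] {Cof : MorphismProperty M}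
    [Cof.RespectsIso] {X I : M} (hI : IsInitial I) (h : Cof (hI.to X)) : CofibrantFor Cof X := by
  intro J hJ
  have : hJ.to X = (hI.uniqueUpToIso hJ).inv ≫ hI.to X := hJ.hom_ext _ _
  rw [this]
  exact MorphismProperty.RespectsIso.precomp _ _ _ h

section ModelStructures

variable {M : Type u} [Category.{v} M] (S : ModelCategory M)

lemma isFibrant_of_fibrantFor {X : M} (hX : FibrantFor (fib S) X) :
    letI := S
    IsFibrant X := by
  let := S
  rw [isFibrant_iff]
  exact ⟨hX terminalIsTerminal⟩

/-- The source of a fibration with fibrant target is fibrant. -/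
lemma FibrantFor.of_fib {X Y : M} {f : X ⟶ Y} (hf : fib S f) (hY : FibrantFor (fib S) Y) :
    FibrantFor (fib S) X := by
  let := S
  intro I hI
  rw [← hI.comp_from f]
  exact (fibrations M).comp_mem _ _ hf (hY hI)

end ModelStructures

/-! ### Local equivalences and local objects. -/

namespace IsLeftBousfieldLocalization

variable {M : Type u} [Category.{v} M] {S L : ModelCategory M} {C : MorphismProperty M}

/-- Ken Brown's lemma: in `f = i ≫ p`, both `p` and the retraction `r` of `i` are trivial fibrations
of `L`, hence of `S`; two-out-of-three in `S` then handles `i`. -/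
lemma weq_of_fibrant (hL : IsLeftBousfieldLocalization S L C) {X Y : M} {f : X ⟶ Y}
    (hX : FibrantFor (fib L) X) (hY : FibrantFor (fib L) Y) (hf : weq L f) : weq S f := by
  have := isFibrant_of_fibrantFor L hX
  have := isFibrant_of_fibrantFor L hY
  let := L
  have hf' : WeakEquivalence f := ⟨hf⟩
  obtain ⟨b⟩ : Nonempty (FibrantBrownFactorization f) := inferInstance
  have hp : (fib S ⊓ weq S) b.p := by
    rw [← hL.trivFib_eq]
    exact ⟨b.hp, (weakEquivalences M).of_precomp b.i b.p b.hi.2 (by rw [b.fac]; exact hf)⟩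
  have hr : (fib S ⊓ weq S) b.r := by
    rw [← hL.trivFib_eq]
    refine ⟨b.fibration_r.mem, (weakEquivalences M).of_precomp b.i b.r b.hi.2 ?_⟩
    rw [b.i_r]
    exact (weakEquivalences M).id_mem _
  have hi : weq S b.i := by
    refine S.cm2.of_postcomp b.i b.r hr.2 ?_
    rw [b.i_r]
    exact weq_id S _
  rw [← b.fac]
  exact S.cm2.comp_mem _ _ hi hp.2

/-- The localization functor inverts the weak equivalences of the localized model structure. -/
lemma isIso_loc_map (hL : IsLeftBousfieldLocalization S L C) {X Y : M} {f : X ⟶ Y}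
    (hf : weq L f) : IsIso (hL.loc.map ((toHo S).map f)) := by
  have := hL.isLeftDerived
  have : IsIso hL.leftCounit :=
    Functor.isIso_of_isLeftDerivedFunctor_of_inverts _ hL.leftCounit hL.inverts_left
  have : IsIso ((𝟭 M ⋙ toHo L).map f) := Localization.inverts (weq L).Q (weq L) f hf
  have : IsIso ((toHo S ⋙ hL.leftDerivedId).map f) :=
    (NatIso.isIso_map_iff (asIso hL.leftCounit) f).2 this
  exact inferInstanceAs (IsIso (hL.rightDerivedId.map ((toHo S ⋙ hL.leftDerivedId).map f)))

/-- The underived unit is an identity, so the unit of the derived adjunction is `rightUnit` up to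
the invertible `leftCounit`. Invertibility of `l` can thus be read off from `rightUnit`. -/
lemma locMap_app_comp_leftCounit (hL : IsLeftBousfieldLocalization S L C) (X : M) :
    hL.locMap.app ((toHo S).obj X) ≫ hL.rightDerivedId.map (hL.leftCounit.app X) =
      hL.rightUnit.app X := by
  have := hL.isLeftDerived
  have := hL.isRightDerived
  have := hL.isLeftDerived_comp
  have := hL.isRightDerived_comp
  refine ((Adjunction.id (C := M)).derivedη_fac_app (weq S) hL.leftCounit hL.rightUnit X).trans ?_
  have e : (toHo S).map ((Adjunction.id (C := M)).unit.app X) = 𝟙 _ := (toHo S).map_id X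
  exact (congrArg (· ≫ hL.rightUnit.app X) e).trans (Category.id_comp _)

/-- Fibrant objects of the localized model structure are local. -/
lemma isIso_locMap_app (hL : IsLeftBousfieldLocalization S L C) {X : M}
    (hX : FibrantFor (fib L) X) : IsIso (hL.locMap.app ((toHo S).obj X)) := by
  have := hL.isLeftDerived
  have := hL.isRightDerived
  have : IsIso hL.leftCounit :=
    Functor.isIso_of_isLeftDerivedFunctor_of_inverts _ hL.leftCounit hL.inverts_left
  have hX' := isFibrant_of_fibrantFor L hX
  have : IsIso (hL.rightUnit.app X) := by
    let := L
    exact hL.derives_right.isIso_of_isRightDerivedFunctor hL.rightUnit (FibrantObject.mk X)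
  rw [← hL.locMap_app_comp_leftCounit] at this
  have h : IsIso (hL.rightDerivedId.map (hL.leftCounit.app X)) := Functor.map_isIso _ _
  exact @IsIso.of_isIso_comp_right _ _ _ _ _ _ _ h this

/-- Maps into a local object are determined by their restriction along a map inverted by the
localization. -/
lemma hom_ext (hL : IsLeftBousfieldLocalization S L C) {X Y Z : Ho S} (f : X ⟶ Y)
    [IsIso (hL.loc.map f)] [IsIso (hL.locMap.app Z)] {g g' : Y ⟶ Z} (h : f ≫ g = f ≫ g') :
    g = g' := by
  have h' : hL.loc.map g = hL.loc.map g' := by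
    rw [← cancel_epi (hL.loc.map f), ← Functor.map_comp, ← Functor.map_comp, h]
  -- By naturality of `l`, the map `g ≫ l_Z` depends only on `L_C g`.
  rw [← cancel_mono (hL.locMap.app Z)]
  have e₁ := hL.locMap.naturality g
  have e₂ := hL.locMap.naturality g'
  dsimp at e₁ e₂
  rw [e₁, e₂, h']

end IsLeftBousfieldLocalization

/-! ### Idempotence and generalities on homotopy categories. -/

/-- A coaugmented endofunctor whose two canonical maps are isomorphisms is idempotent. -/
lemma coaugmentation_app_eq_map {H : Type*} [Category* H] {G : H ⥤ H} (η : 𝟭 H ⟶ G)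
    (h₁ : ∀ X, IsIso (η.app (G.obj X))) (h₂ : ∀ X, IsIso (G.map (η.app X))) (X : H) :
    η.app (G.obj X) = G.map (η.app X) := by
  -- Naturality equates the two maps only after precomposition with `η_X`, which need not be epi; it
  -- becomes invertible after applying `G`. Naturality at the invertible `η` on `G (G X)` then
  -- removes the extra `G`.
  have h : η.app X ≫ η.app (G.obj X) = η.app X ≫ G.map (η.app X) := η.naturality (η.app X)
  have := h₁ (G.obj X)
  have := h₂ X
  have e : G.map (η.app (G.obj X)) = G.map (G.map (η.app X)) := by
    rw [← cancel_epi (G.map (η.app X)), ← Functor.map_comp, ← Functor.map_comp, h]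
  rw [← cancel_mono (η.app (G.obj (G.obj X)))]
  have e₁ := η.naturality (η.app (G.obj X))
  have e₂ := η.naturality (G.map (η.app X))
  dsimp at e₁ e₂
  rw [e₁, e₂, e]

lemma isIso_app_of_toHo {M : Type u} [Category.{v} M] {D : Type u'} [Category.{v'} D]
    {F : M ⥤ D} {U : D ⥤ M} {adj : F ⊣ U} {S : ModelCategory M} (A : SemiModelStructure adj S)
    {H : Type*} [Category* H] {G G' : A.Ho ⥤ H} (η : G ⟶ G')
    (h : ∀ E, IsIso (η.app (A.toHo.obj E))) (X : A.Ho) : IsIso (η.app X) := by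
  have := Localization.essSurj A.toHo A.weq
  exact (NatTrans.isIso_app_iff_of_iso η (A.toHo.objObjPreimageIso X)).1 (h _)

lemma isIso_map_of_isIso_map_comp {H H' : Type*} [Category* H] [Category* H'] (G : H ⥤ H')
    {X Y Z W : H} {f : X ⟶ Y} {g : Y ⟶ Z} {h : Z ⟶ W} [IsIso f] [IsIso h]
    (hG : IsIso (G.map (f ≫ g ≫ h))) : IsIso (G.map g) := by
  rw [Functor.map_comp, Functor.map_comp] at hG
  have := IsIso.of_isIso_comp_left (G.map f) (G.map g ≫ G.map h)
  exact IsIso.of_isIso_comp_right (G.map g) (G.map h)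

/-! ### Fibrant replacement of algebras. -/

namespace SemiModelStructure

variable {M : Type u} [Category.{v} M] {D : Type u'} [Category.{v'} D]
  {F : M ⥤ D} {U : D ⥤ M} {adj : F ⊣ U} {S L : ModelCategory M}

/-- The functor sending `E` to the arrow from the initial object to `E`. -/
@[simps]
def fromInitial (D : Type u) [Category.{v} D] [HasInitial D] : D ⥤ Arrow D where
  obj E := Arrow.mk (initial.to E)
  map f := Arrow.homMk (𝟙 _) f

/-- The functor sending `E` to the arrow from `E` to the terminal object. -/
@[simps]
def toTerminal (D : Type u) [Category.{v} D] [HasTerminal D] : D ⥤ Arrow D where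
  obj E := Arrow.mk (terminal.from E)
  map f := Arrow.homMk f (𝟙 _)

/-- The second factorization exists only for cofibrant domains, so `E` is first replaced by `Q E`,
from factoring `∅ ⟶ E`; then `Q E ⟶ *` is factored. -/
lemma nonempty_fibrantReplacement (B : SemiModelStructure adj L) :
    Nonempty B.FibrantReplacement := by
  have := B.hasLimits
  have := B.hasColimits
  have := B.cof_retract
  have := B.fib_retract
  have := B.factor_cof
  have : HasInitial D := inferInstance
  have : HasTerminal D := inferInstance
  let d := MorphismProperty.functorialFactorizationData B.cof (B.fib ⊓ B.weq)
  obtain ⟨d'⟩ := B.factor_trivCof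
  let Q : D ⥤ D := fromInitial D ⋙ d.Z
  have hQ (E : D) : CofibrantFor B.cof (Q.obj E) := by
    refine .of_isInitial initialIsInitial ?_
    have h : initialIsInitial.to (Q.obj E) = d.i.app ((fromInitial D).obj E) :=
      initialIsInitial.hom_ext _ _
    exact h ▸ d.hi _
  let G := ObjectProperty.lift (fun f : Arrow D => CofibrantFor B.cof f.left) (Q ⋙ toTerminal D) hQ
  exact ⟨{
    Q := Q
    R := G ⋙ d'.Z
    q := { app E := d.p.app ((fromInitial D).obj E)
           naturality _ _ f := d.p.naturality ((fromInitial D).map f) }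
    j := { app E := d'.i.app (G.obj E)
           naturality _ _ f := d'.i.naturality (G.map f) }
    cofibrant := hQ
    trivFib_q E := d.hp _
    trivCof_j E := d'.hi _
    fibrant E := by
      refine .of_isTerminal terminalIsTerminal ?_
      have h : terminalIsTerminal.from ((G ⋙ d'.Z).obj E) = d'.p.app (G.obj E) :=
        terminalIsTerminal.hom_ext _ _
      exact h ▸ d'.hp _ }⟩

lemma fibrantFor_map (B : SemiModelStructure adj L) {E : D} (hE : FibrantFor B.fib E) :
    FibrantFor (LocAlg.fib L) (U.obj E) := by
  have := adj.rightAdjoint_preservesLimits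
  have := B.hasLimits
  have : HasTerminal D := inferInstance
  let := L
  refine .of_isTerminal (isLimitChangeEmptyCone _ (isLimitOfHasTerminalOfPreservesLimit U) _
    (Iso.refl _)) ?_
  convert (B.fib_iff _).1 (hE terminalIsTerminal) using 1
  exact IsTerminal.hom_ext (isLimitOfHasTerminalOfPreservesLimit U) _ _

namespace FibrantReplacement

section

variable {B : SemiModelStructure adj L} (ρ : B.FibrantReplacement)

lemma fibrantFor_map_R (E : D) : FibrantFor (LocAlg.fib L) (U.obj (ρ.R.obj E)) :=
  B.fibrantFor_map (ρ.fibrant E)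

lemma weq_Q_map {E E' : D} {f : E ⟶ E'} (hf : B.weq f) : B.weq (ρ.Q.map f) := by
  have := B.twoOutOfThree
  refine B.weq.of_postcomp _ (ρ.q.app E') (ρ.trivFib_q E').2 ?_
  rw [ρ.q.naturality]
  exact B.weq.comp_mem _ _ (ρ.trivFib_q E).2 hf

lemma weq_R_map {E E' : D} {f : E ⟶ E'} (hf : B.weq f) : B.weq (ρ.R.map f) := by
  have := B.twoOutOfThree
  refine B.weq.of_precomp (ρ.j.app E) _ (ρ.trivCof_j E).2 ?_
  rw [← ρ.j.naturality]
  exact B.weq.comp_mem _ _ (ρ.weq_Q_map hf) (ρ.trivCof_j E').2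

lemma exists_lift (E : D) {Z : M} {k : U.obj (ρ.Q.obj E) ⟶ Z}
    (hk : (LocAlg.cof L ⊓ LocAlg.weq L) k) :
    ∃ β : Z ⟶ U.obj (ρ.R.obj E), k ≫ β = U.map (ρ.j.app E) := by
  have := isFibrant_of_fibrantFor L (ρ.fibrantFor_map_R E)
  let := L
  have : Cofibration k := ⟨hk.1⟩
  have : WeakEquivalence k := ⟨hk.2⟩
  have sq : CommSq (U.map (ρ.j.app E)) k (terminal.from _) (terminal.from _) :=
    ⟨Subsingleton.elim _ _⟩
  exact ⟨sq.lift, sq.fac_left⟩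

end

variable {C : MorphismProperty M} (hL : IsLeftBousfieldLocalization S L C)
  {A : SemiModelStructure adj S} (hA : A.IsTransferred)
  {B : SemiModelStructure adj L} (hB : B.IsTransferred) (ρ : B.FibrantReplacement)

include hL in
-- This gives homotopy uniqueness of `β`: `U (R E)` is local and `k` is a local equivalence.
lemma toHo_map_ext (E : D) {X Z : M} {k : X ⟶ Z} (hk : LocAlg.weq L k)
    {g g' : (LocAlg.toHo S).obj Z ⟶ (LocAlg.toHo S).obj (U.obj (ρ.R.obj E))}
    (h : (LocAlg.toHo S).map k ≫ g = (LocAlg.toHo S).map k ≫ g') : g = g' := by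
  have := hL.isIso_loc_map hk
  have := hL.isIso_locMap_app (ρ.fibrantFor_map_R E)
  exact hL.hom_ext ((LocAlg.toHo S).map k) h

include hL in
lemma weq_lift (E : D) {Z : M} {k : U.obj (ρ.Q.obj E) ⟶ Z}
    (hk : LocAlg.weq L k) (hZ : FibrantFor (LocAlg.fib L) Z) (hj : LocAlg.weq L (U.map (ρ.j.app E)))
    {β : Z ⟶ U.obj (ρ.R.obj E)} (hβ : k ≫ β = U.map (ρ.j.app E)) : LocAlg.weq S β :=
  hL.weq_of_fibrant hZ (ρ.fibrantFor_map_R E) (L.cm2.of_precomp k β hk (hβ ▸ hj))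

include hL hA

/-- Being a trivial fibration means the same over `L` and over `S`, so `q` is invertible already in
`A.Ho`. -/
lemma weq_q (E : D) : A.weq (ρ.q.app E) := by
  have h : (LocAlg.fib L ⊓ LocAlg.weq L) (U.map (ρ.q.app E)) :=
    (B.trivFib_iff _).1 (ρ.trivFib_q E)
  rw [hL.trivFib_eq] at h
  exact (hA.weq_iff _).2 h.2

lemma isIso_map_q (E : D) : IsIso (A.toHo.map (ρ.q.app E)) :=
  Localization.inverts A.toHo A.weq _ (weq_q hL hA ρ E)

/-- The identification of a fibrant replacement `Z` of `U (Q E)` with `L_C (U E)`. -/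
lemma exists_iso_loc (E : D) {Z : M} {k : U.obj (ρ.Q.obj E) ⟶ Z}
    (hk : LocAlg.weq L k) (hZ : FibrantFor (LocAlg.fib L) Z) :
    ∃ a : (LocAlg.toHo S).obj Z ≅ hL.loc.obj (hA.hoU.obj (A.toHo.obj E)),
      (LocAlg.toHo S).map k ≫ a.hom =
        (LocAlg.toHo S).map (U.map (ρ.q.app E)) ≫ hA.hoUIso.inv.app E ≫
          hL.locMap.app (hA.hoU.obj (A.toHo.obj E)) := by
  have := hL.isIso_loc_map hk
  have := hL.isIso_locMap_app hZ
  have : IsIso ((LocAlg.toHo S).map (U.map (ρ.q.app E))) :=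
    Localization.inverts (LocAlg.toHo S) (LocAlg.weq S) _ ((hA.weq_iff _).1 (weq_q hL hA ρ E))
  let r : (LocAlg.toHo S).obj (U.obj (ρ.Q.obj E)) ≅ hA.hoU.obj (A.toHo.obj E) :=
    asIso ((LocAlg.toHo S).map (U.map (ρ.q.app E))) ≪≫ (hA.hoUIso.app E).symm
  -- The path is `Z ≅ L_C Z ≅ L_C U Q E ≅ L_C U E`, through `l_Z`, the inverse of `L_C k`, and `L_C
  -- (U q)`.
  refine ⟨asIso (hL.locMap.app ((LocAlg.toHo S).obj Z)) ≪≫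
    (asIso (hL.loc.map ((LocAlg.toHo S).map k))).symm ≪≫ hL.loc.mapIso r, ?_⟩
  have e₁ := hL.locMap.naturality ((LocAlg.toHo S).map k)
  have e₂ := hL.locMap.naturality r.hom
  dsimp only [Functor.id_map, Functor.id_obj, Functor.comp_obj] at e₁ e₂
  dsimp only [Iso.trans_hom, asIso_hom, Iso.symm_hom, asIso_inv, Functor.mapIso_hom]
  rw [reassoc_of% e₁, IsIso.hom_inv_id_assoc, ← e₂]
  exact Category.assoc _ _ _

/-- The natural map `E ⟵ Q E ⟶ R E` in the homotopy category. -/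
def toR : A.toHo ⟶ ρ.R ⋙ A.toHo where
  app E := haveI := isIso_map_q hL hA ρ E; inv (A.toHo.map (ρ.q.app E)) ≫ A.toHo.map (ρ.j.app E)
  naturality E E' f := by
    have := isIso_map_q hL hA ρ E
    have := isIso_map_q hL hA ρ E'
    have e₁ := ρ.q.naturality f
    have e₂ := ρ.j.naturality f
    dsimp at e₁ e₂ ⊢
    rw [Category.assoc, ← Functor.map_comp, ← e₂, ← cancel_epi (A.toHo.map (ρ.q.app E)),
      IsIso.hom_inv_id_assoc, ← Functor.map_comp_assoc, ← e₁, Functor.map_comp_assoc,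
      IsIso.hom_inv_id_assoc, Functor.map_comp]

lemma map_q_toR_app (E : D) :
    A.toHo.map (ρ.q.app E) ≫ (toR hL hA ρ).app E = A.toHo.map (ρ.j.app E) := by
  have := isIso_map_q hL hA ρ E
  exact IsIso.hom_inv_id_assoc _ _

/-! ### The functor induced by fibrant replacement and its comparison with `L_C`. -/

include hB

lemma weq_of_weq {E E' : D} {f : E ⟶ E'} (hf : A.weq f) : B.weq f :=
  (hB.weq_iff f).2 (hL.weq_le _ ((hA.weq_iff f).1 hf))

lemma weq_of_fibrant {E E' : D} {f : E ⟶ E'} (hE : FibrantFor (LocAlg.fib L) (U.obj E))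
    (hE' : FibrantFor (LocAlg.fib L) (U.obj E')) (hf : B.weq f) : A.weq f :=
  (hA.weq_iff f).2 (hL.weq_of_fibrant hE hE' ((hB.weq_iff f).1 hf))

lemma inverts_R : A.weq.IsInvertedBy (ρ.R ⋙ A.toHo) := fun _ _ _ hf =>
  Localization.inverts A.toHo A.weq _ (weq_of_fibrant hL hA hB (ρ.fibrantFor_map_R _)
    (ρ.fibrantFor_map_R _) (ρ.weq_R_map (weq_of_weq hL hA hB hf)))

/-- The object `U (Q (R E))` is locally fibrant, since `U q` is a fibration onto `U (R E)`. -/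
lemma isIso_map_j_R (E : D) : IsIso (A.toHo.map (ρ.j.app (ρ.R.obj E))) :=
  Localization.inverts A.toHo A.weq _ (weq_of_fibrant hL hA hB
    (.of_fib L ((B.fib_iff _).1 (ρ.trivFib_q _).1) (ρ.fibrantFor_map_R E))
    (ρ.fibrantFor_map_R _) (ρ.trivCof_j _).2)

lemma isIso_map_R_j (E : D) : IsIso (A.toHo.map (ρ.R.map (ρ.j.app E))) :=
  Localization.inverts A.toHo A.weq _ (weq_of_fibrant hL hA hB (ρ.fibrantFor_map_R _)
    (ρ.fibrantFor_map_R _) (ρ.weq_R_map (ρ.trivCof_j E).2))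

/-- The endofunctor of the homotopy category induced by fibrant replacement. -/
def hoR : A.Ho ⥤ A.Ho := Localization.lift (ρ.R ⋙ A.toHo) (inverts_R hL hA hB ρ) A.toHo

/-- `hoR` is given by fibrant replacement. -/
def hoRIso : A.toHo ⋙ hoR hL hA hB ρ ≅ ρ.R ⋙ A.toHo :=
  Localization.fac (ρ.R ⋙ A.toHo) (inverts_R hL hA hB ρ) A.toHo

/-- The localization map of `hoR`. -/
def toHoR : 𝟭 A.Ho ⟶ hoR hL hA hB ρ :=
  letI : Localization.Lifting A.toHo A.weq (ρ.R ⋙ A.toHo) (hoR hL hA hB ρ) := ⟨hoRIso hL hA hB ρ⟩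
  Localization.liftNatTrans A.toHo A.weq A.toHo (ρ.R ⋙ A.toHo) _ _ (toR hL hA ρ)

lemma toHoR_app (E : D) : (toHoR hL hA hB ρ).app (A.toHo.obj E) =
    (toR hL hA ρ).app E ≫ (hoRIso hL hA hB ρ).inv.app E := by
  let : Localization.Lifting A.toHo A.weq (ρ.R ⋙ A.toHo) (hoR hL hA hB ρ) := ⟨hoRIso hL hA hB ρ⟩
  exact (Localization.liftNatTrans_app ..).trans (Category.id_comp _)

lemma map_q_toHoR_app (E : D) : A.toHo.map (ρ.q.app E) ≫
    (toHoR hL hA hB ρ).app (A.toHo.obj E) ≫ (hoRIso hL hA hB ρ).hom.app E =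
      A.toHo.map (ρ.j.app E) := by
  rw [toHoR_app, Category.assoc, Iso.inv_hom_id_app, Category.comp_id]
  exact map_q_toR_app hL hA ρ E

lemma isIso_toHoR_app_hoR (X : A.Ho) :
    IsIso ((toHoR hL hA hB ρ).app ((hoR hL hA hB ρ).obj X)) := by
  refine isIso_app_of_toHo A (Functor.whiskerLeft (hoR hL hA hB ρ) (toHoR hL hA hB ρ)) (fun E => ?_) X
  refine (NatTrans.isIso_app_iff_of_iso (toHoR hL hA hB ρ) ((hoRIso hL hA hB ρ).app E)).2 ?_
  have := isIso_map_q hL hA ρ (ρ.R.obj E)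
  have := isIso_map_j_R hL hA hB ρ E
  have h : IsIso ((toR hL hA ρ).app (ρ.R.obj E)) := by
    dsimp only [toR]
    infer_instance
  have e := toHoR_app hL hA hB ρ (ρ.R.obj E)
  exact e ▸ IsIso.comp_isIso' h inferInstance

lemma isIso_hoR_map_toHoR_app (X : A.Ho) :
    IsIso ((hoR hL hA hB ρ).map ((toHoR hL hA hB ρ).app X)) := by
  refine isIso_app_of_toHo A (Functor.whiskerRight (toHoR hL hA hB ρ) (hoR hL hA hB ρ))
    (fun E => ?_) X
  have := isIso_map_q hL hA ρ E
  have hj : IsIso ((hoR hL hA hB ρ).map (A.toHo.map (ρ.j.app E))) :=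
    (NatIso.isIso_map_iff (hoRIso hL hA hB ρ) (ρ.j.app E)).2 (isIso_map_R_j hL hA hB ρ E)
  rw [← map_q_toHoR_app hL hA hB] at hj
  exact isIso_map_of_isIso_map_comp (hoR hL hA hB ρ) hj

lemma isIso_loc_map_hoU_map_toHoR_app (X : A.Ho) :
    IsIso (hL.loc.map (hA.hoU.map ((toHoR hL hA hB ρ).app X))) := by
  refine isIso_app_of_toHo A (Functor.whiskerRight (toHoR hL hA hB ρ) (hA.hoU ⋙ hL.loc))
    (fun E => ?_) X
  let G := hA.hoU ⋙ hL.loc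
  have := isIso_map_q hL hA ρ E
  have hj : IsIso (G.map (A.toHo.map (ρ.j.app E))) :=
    (NatIso.isIso_map_iff (Functor.isoWhiskerRight hA.hoUIso hL.loc) (ρ.j.app E)).2
      (hL.isIso_loc_map ((hB.weq_iff _).1 (ρ.trivCof_j E).2))
  -- The coaugmentation differs from `j` only by isomorphisms, so invertibility passes from `j` to
  -- it.
  rw [← map_q_toHoR_app hL hA hB] at hj
  exact isIso_map_of_isIso_map_comp G hj

lemma isIso_locMap_app_hoU_hoR (X : A.Ho) :
    IsIso (hL.locMap.app (hA.hoU.obj ((hoR hL hA hB ρ).obj X))) := by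
  refine isIso_app_of_toHo A (Functor.whiskerLeft (hoR hL hA hB ρ ⋙ hA.hoU) hL.locMap)
    (fun E => ?_) X
  exact (NatTrans.isIso_app_iff_of_iso hL.locMap
    (hA.hoU.mapIso ((hoRIso hL hA hB ρ).app E) ≪≫ hA.hoUIso.app (ρ.R.obj E))).2
      (hL.isIso_locMap_app (ρ.fibrantFor_map_R E))

/-- The comparison `L_C U ≅ U R` on homotopy categories. -/
def locIso : hA.hoU ⋙ hL.loc ≅ hoR hL hA hB ρ ⋙ hA.hoU :=
  haveI (X : A.Ho) := isIso_loc_map_hoU_map_toHoR_app hL hA hB ρ X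
  haveI (X : A.Ho) := isIso_locMap_app_hoU_hoR hL hA hB ρ X
  NatIso.ofComponents (fun X =>
    asIso (hL.loc.map (hA.hoU.map ((toHoR hL hA hB ρ).app X))) ≪≫
      (asIso (hL.locMap.app (hA.hoU.obj ((hoR hL hA hB ρ).obj X)))).symm) (by
    intro X Y f
    have e₁ := (toHoR hL hA hB ρ).naturality f
    have e₂ := hL.locMap.naturality (hA.hoU.map ((hoR hL hA hB ρ).map f))
    dsimp at e₁ e₂ ⊢
    rw [← cancel_mono (hL.locMap.app (hA.hoU.obj ((hoR hL hA hB ρ).obj Y)))]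
    simp only [Category.assoc, IsIso.inv_hom_id, Category.comp_id]
    rw [e₂, IsIso.inv_hom_id_assoc, ← Functor.map_comp, ← Functor.map_comp, e₁,
      Functor.map_comp, Functor.map_comp])

lemma locMap_app_comp_locIso (X : A.Ho) :
    hL.locMap.app (hA.hoU.obj X) ≫ (locIso hL hA hB ρ).hom.app X =
      hA.hoU.map ((toHoR hL hA hB ρ).app X) := by
  have := isIso_locMap_app_hoU_hoR hL hA hB ρ X
  have e := hL.locMap.naturality (hA.hoU.map ((toHoR hL hA hB ρ).app X))
  dsimp [locIso] at e ⊢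
  rw [← reassoc_of% e, IsIso.hom_inv_id, Category.comp_id]

/-- The lift of the localization given by fibrant replacement. -/
def homotopyLift : HomotopyLift hL hA where
  LT := hoR hL hA hB ρ
  lT := toHoR hL hA hB ρ
  idem := coaugmentation_app_eq_map _ (isIso_toHoR_app_hoR hL hA hB ρ)
    (isIso_hoR_map_toHoR_app hL hA hB ρ)
  isIso_idem := isIso_hoR_map_toHoR_app hL hA hB ρ
  h := locIso hL hA hB ρ
  comm := locMap_app_comp_locIso hL hA hB ρ

/-- The lift `homotopyLift` is given by fibrant replacement. -/
def homotopyLiftGivenBy : (homotopyLift hL hA hB ρ).GivenBy ρ where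
  e := hoRIso hL hA hB ρ
  fac := map_q_toHoR_app hL hA hB ρ

/-- Both sides map into the local object `U (R E)`, so it suffices to compare them after `k`, where
each becomes `U j`. -/
lemma iso_loc_comp_locIso (E : D) {Z : M} {k : U.obj (ρ.Q.obj E) ⟶ Z} (hk : LocAlg.weq L k)
    {a : (LocAlg.toHo S).obj Z ⟶ hL.loc.obj (hA.hoU.obj (A.toHo.obj E))}
    (ha : (LocAlg.toHo S).map k ≫ a =
      (LocAlg.toHo S).map (U.map (ρ.q.app E)) ≫ hA.hoUIso.inv.app E ≫
        hL.locMap.app (hA.hoU.obj (A.toHo.obj E)))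
    {β : Z ⟶ U.obj (ρ.R.obj E)} (hβ : k ≫ β = U.map (ρ.j.app E)) :
    a ≫ (locIso hL hA hB ρ).hom.app (A.toHo.obj E) ≫
      hA.hoU.map ((hoRIso hL hA hB ρ).hom.app E) ≫ hA.hoUIso.hom.app (ρ.R.obj E) =
        (LocAlg.toHo S).map β := by
  refine toHo_map_ext hL ρ E hk ?_
  have e₁ := hA.hoUIso.inv.naturality (ρ.q.app E)
  have e₂ := hA.hoUIso.inv.naturality (ρ.j.app E)
  have e₃ := locMap_app_comp_locIso hL hA hB ρ (A.toHo.obj E)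
  have e₄ := congrArg hA.hoU.map (map_q_toHoR_app hL hA hB ρ E)
  rw [Functor.map_comp, Functor.map_comp] at e₄
  dsimp only [Functor.comp_map, Functor.comp_obj, Functor.id_obj] at e₁ e₂ e₄
  rw [reassoc_of% ha, reassoc_of% e₃, reassoc_of% e₁, reassoc_of% e₄, ← reassoc_of% e₂,
    Iso.inv_hom_id_app, ← Functor.map_comp, hβ]
  exact Category.comp_id _

end FibrantReplacement

end SemiModelStructure

end LocAlg

end

theorem mainTheorem8 {M : Type u} [Category.{v} M] (S L : ModelCategory M)
    (C : MorphismProperty M)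
    (hC : ∀ ⦃X Y : M⦄ (f : X ⟶ Y), C f → LocAlg.cof S f ∧
      LocAlg.CofibrantFor (LocAlg.cof S) X ∧ LocAlg.CofibrantFor (LocAlg.cof S) Y)
    (hL : LocAlg.IsLeftBousfieldLocalization S L C)
    (T : Monad M)
    (A : LocAlg.SemiModelStructure T.adj S) (hA : A.IsTransferred)
    (B : LocAlg.SemiModelStructure T.adj L) (hB : B.IsTransferred) :
    Nonempty B.FibrantReplacement ∧
    ∀ ρ : B.FibrantReplacement,
      ∃ (Λ : LocAlg.HomotopyLift hL hA) (g : Λ.GivenBy ρ),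
        ∀ (E : T.Algebra) (Z : M) (k : T.forget.obj (ρ.Q.obj E) ⟶ Z),
          (LocAlg.cof L ⊓ LocAlg.weq L) k → LocAlg.FibrantFor (LocAlg.fib L) Z →
          (∃ β : Z ⟶ T.forget.obj (ρ.R.obj E), k ≫ β = T.forget.map (ρ.j.app E)) ∧
          (∀ β β' : Z ⟶ T.forget.obj (ρ.R.obj E), k ≫ β = T.forget.map (ρ.j.app E) →
            k ≫ β' = T.forget.map (ρ.j.app E) →
            (LocAlg.toHo S).map β = (LocAlg.toHo S).map β') ∧
          ∃ a : (LocAlg.toHo S).obj Z ≅ hL.loc.obj (hA.hoU.obj (A.toHo.obj E)),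
            (LocAlg.toHo S).map k ≫ a.hom =
              (LocAlg.toHo S).map (T.forget.map (ρ.q.app E)) ≫ hA.hoUIso.inv.app E ≫
                hL.locMap.app (hA.hoU.obj (A.toHo.obj E)) ∧
            ∀ β : Z ⟶ T.forget.obj (ρ.R.obj E), k ≫ β = T.forget.map (ρ.j.app E) →
              LocAlg.weq S β ∧
              a.hom ≫ Λ.h.hom.app (A.toHo.obj E) ≫ hA.hoU.map (g.e.hom.app E) ≫
                hA.hoUIso.hom.app (ρ.R.obj E) = (LocAlg.toHo S).map β := by
  refine ⟨B.nonempty_fibrantReplacement, fun ρ => ⟨ρ.homotopyLift hL hA hB,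
    ρ.homotopyLiftGivenBy hL hA hB, fun E Z k hk hZ => ⟨ρ.exists_lift E hk,
      fun β β' hβ hβ' => ρ.toHo_map_ext hL E hk.2 ?_, ?_⟩⟩⟩
  · rw [← Functor.map_comp, ← Functor.map_comp, hβ, hβ']
  · obtain ⟨a, ha⟩ := ρ.exists_iso_loc hL hA E hk.2 hZ
    exact ⟨a, ha, fun β hβ => ⟨ρ.weq_lift hL E hk.2 hZ ((hB.weq_iff _).1 (ρ.trivCof_j E).2) hβ,
      ρ.iso_loc_comp_locIso hL hA hB E hk.2 ha hβ⟩⟩
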